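/- Let $\mathcal O$ be an oriented matroid on a finite ground set $E$ with set of signed cocircuits $\mathcal C$, and let $f\in E$. For a sign vector $X$ write $z(X)=\{e\in E: X_e=0\}$. An oriented matroid program $(\mathcal O,g,f)$ consists of an oriented matroid and two distinct elements $g,f$ of its ground set such that $g$ is not a loop and $f$ is not a coloop. Its graph $G_f$ has as vertices the cocircuits $X$ with $X_g=+$. Two vertices $X,Y$ are joined by an edge if they are conformal (no element has opposite nonzero signs in $X$ and $Y$) and comodular ($z(X)\cap z(Y)$ is a flat of corank $2$ of the underlying matroid). Let $Z$ be the cocircuit obtained by eliminating $g$ between $-X$ and $Y$ (it is unique); the edge is directed $X\to Y$ if $Z_f=+$, directed $Y\to X$ if $Z_f=-$, and undirected if $Z_f=0$. A directed cycle is a closed path in $G_f$, without repeated vertices apart from its two equal end vertices, in which each edge is either undirected or directed forwards and not all edges are undirected. The program is *Euclidean* if $G_f$ contains no directed cycle. An element is *in general position* if it lies in no non-spanning circuit of the underlying matroid. **Theorem.** Let $k\ge 1$ and let $I=[e_1,\dots,e_k]$ be an ordered set of independent elements of $E$. Let $l\in\{1,\dots,k\}$ be the smallest index with $f\in\operatorname{cl}(\{e_1,\dots,e_l\})$,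 and put $l=k+1$ if there is no such index. Assume: 1. $(\mathcal O/\{e_1,\dots,e_{i-1}\},\,e_i,\,f)$ is a Euclidean oriented matroid program for all $1\le i<l$; 2. if $f$ is not in general position or $f\in I$, then $(\mathcal O/\{e_1,\dots,e_{i-1}\},\,e_i,\,e_j)$ is a Euclidean oriented matroid program for all $1\le i\le\min(l,k-1)$ and $i<j\le k$. Let $\mathcal O'=\mathcal O\cup p$ be the positive lexicographic extension $\mathcal O[e_1^+,\dots,e_k^+]$, that is, the single-element extension of $\mathcal O$ by a new element $p$ such that for every $Y\in\mathcal C$ the sign vector $(Y,\sigma(Y))$ is a cocircuit of $\mathcal O'$, where $\sigma(Y)=Y_{e_i}$ for the smallest $i$ with $Y_{e_i}\ne0$, and $\sigma(Y)=0$ if $Y_{e_1}=\dots=Y_{e_k}=0$. Then $(\mathcal O',p,f)$ is a Euclidean oriented matroid program. -/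

import Mathlib

open Set

/-- A sign vector with entries in `{-, 0, +}`, indexed by `α`. -/
abbrev SignVector (α : Type*) := α → SignType

/-- An oriented matroid on a finite ground set, given by its underlying matroid together with its
set of signed cocircuits: the supports of the signed cocircuits are exactly the cocircuits of the
underlying matroid, every cocircuit carries exactly one pair of opposite sign vectors, and
cocircuit elimination holds. -/
structure OrientedMatroid (α : Type*) where
  /-- the underlying matroid -/
  toMatroid : Matroid α
  finite_ground : toMatroid.E.Finite
  /-- the signed cocircuits -/
  cocircuits : Set (SignVector α)
  isCocircuit_iff : ∀ K : Set α,
    toMatroid.IsCocircuit K ↔ ∃ X ∈ cocircuits, Function.support X = K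
  neg_mem : ∀ X ∈ cocircuits, -X ∈ cocircuits
  eq_or_eq_neg : ∀ X ∈ cocircuits, ∀ Y ∈ cocircuits,
    Function.support X = Function.support Y → X = Y ∨ X = -Y
  elimination : ∀ X ∈ cocircuits, ∀ Y ∈ cocircuits, X ≠ -Y →
    ∀ e, X e ≠ 0 → X e = -Y e →
      ∃ Z ∈ cocircuits, Z e = 0 ∧ ∀ x, Z x ≠ 0 → Z x = X x ∨ Z x = Y x

namespace OrientedMatroid

variable {α : Type*}

/-- The contraction `O / A`: the underlying matroid is contracted, and the signed cocircuits are
those of `O` that vanish on `A`. -/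
def contract (O : OrientedMatroid α) (A : Set α) : OrientedMatroid α where
  toMatroid := O.toMatroid.contract A
  finite_ground := O.finite_ground.subset sdiff_subset
  cocircuits := {X | X ∈ O.cocircuits ∧ ∀ a ∈ A, X a = 0}
  isCocircuit_iff K := by
    rw [Matroid.isCocircuit_def, Matroid.dual_contract, Matroid.delete_isCircuit_iff,
      ← Matroid.isCocircuit_def, O.isCocircuit_iff]
    constructor
    · rintro ⟨⟨X, hX, rfl⟩, hd⟩
      refine ⟨X, ⟨hX, fun a ha => ?_⟩, rfl⟩
      by_contra h
      exact Set.disjoint_left.1 hd h ha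
    · rintro ⟨X, ⟨hX, h0⟩, rfl⟩
      exact ⟨⟨X, hX, rfl⟩, Set.disjoint_left.2 fun a ha haA => ha (h0 a haA)⟩
  neg_mem X hX := ⟨O.neg_mem X hX.1, fun a ha => by simp [hX.2 a ha]⟩
  eq_or_eq_neg X hX Y hY := O.eq_or_eq_neg X hX.1 Y hY.1
  elimination X hX Y hY hne e he hXY := by
    obtain ⟨Z, hZ, hZe, hZs⟩ := O.elimination X hX.1 Y hY.1 hne e he hXY
    refine ⟨Z, ⟨hZ, fun a ha => ?_⟩, hZe, hZs⟩
    by_contra h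
    rcases hZs a h with h' | h'
    · exact h (h'.trans (hX.2 a ha))
    · exact h (h'.trans (hY.2 a ha))

/-- The zero set of a sign vector inside the ground set. -/
def zeroSet (O : OrientedMatroid α) (X : SignVector α) : Set α :=
  {x ∈ O.toMatroid.E | X x = 0}

/-- Two cocircuits are comodular if the zero set `z(X ∘ Y) = z(X) ∩ z(Y)` of their composition is
a coline (a flat of corank two) of the underlying matroid. In particular `X ≠ Y` and `X ≠ -Y`. -/
def Comodular (O : OrientedMatroid α) (X Y : SignVector α) : Prop :=
  O.toMatroid.IsFlat (O.zeroSet X ∩ O.zeroSet Y) ∧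
    O.toMatroid.eRk (O.zeroSet X ∩ O.zeroSet Y) + 2 = O.toMatroid.eRank

/-- Conformal sign vectors: no element has opposite nonzero signs in `X` and `Y`. -/
def Conformal (X Y : SignVector α) : Prop :=
  ∀ x, X x ≠ 0 → Y x ≠ 0 → X x = Y x

/-- `Z` is obtained by cocircuit elimination of `g` between `X` and `Y`. -/
def IsElimination (O : OrientedMatroid α) (g : α) (X Y Z : SignVector α) : Prop :=
  Z ∈ O.cocircuits ∧ Z g = 0 ∧ ∀ x, Z x ≠ 0 → Z x = X x ∨ Z x = Y x

/-- A pair `(X, Y)` of comodular cocircuits with `X_g = Y_g ≠ 0` is directed from `X` to `Y` if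
cocircuit elimination of `g` between `-X` and `Y` yields `Z` with `Z_f = +` (for such pairs, `Z` is
unique). -/
def DirectedTo (O : OrientedMatroid α) (g f : α) (X Y : SignVector α) : Prop :=
  ∃ Z, O.IsElimination g (-X) Y Z ∧ Z f = 1

/-- The pair `(X, Y)` is undirected if cocircuit elimination of `g` between `-X` and `Y` yields `Z`
with `Z_f = 0`. -/
def Undirected (O : OrientedMatroid α) (g f : α) (X Y : SignVector α) : Prop :=
  ∃ Z, O.IsElimination g (-X) Y Z ∧ Z f = 0

/-- The vertices of the graph `G_f` of the program `(O, g, f)`: the cocircuits with `X_g = +`. -/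
def IsVertex (O : OrientedMatroid α) (g : α) (X : SignVector α) : Prop :=
  X ∈ O.cocircuits ∧ X g = 1

/-- The edges of the graph `G_f`: pairs of comodular, conformal vertices. -/
def IsGraphEdge (O : OrientedMatroid α) (g : α) (X Y : SignVector α) : Prop :=
  O.IsVertex g X ∧ O.IsVertex g Y ∧ O.Comodular X Y ∧ Conformal X Y

/-- `P 0, P 1, …, P n = P 0` is a directed cycle in the graph `G_f` of `(O, g, f)`: consecutive
vertices are joined by edges, `P 0, …, P (n-1)` are pairwise distinct, every edge is undirected or
directed forwards, and not all edges are undirected. -/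
def IsDirectedCycle (O : OrientedMatroid α) (g f : α) (n : ℕ) (P : ℕ → SignVector α) : Prop :=
  P n = P 0 ∧
  (∀ i < n, ∀ j < n, P i = P j → i = j) ∧
  (∀ i < n, O.IsGraphEdge g (P i) (P (i + 1))) ∧
  (∀ i < n, O.DirectedTo g f (P i) (P (i + 1)) ∨ O.Undirected g f (P i) (P (i + 1))) ∧
  (∃ i < n, ¬ O.Undirected g f (P i) (P (i + 1)))

/-- `(O, g, f)` is an oriented matroid program: `g` and `f` are distinct elements of the ground
set, `g` is not a loop and `f` is not a coloop. -/
def IsProgram (O : OrientedMatroid α) (g f : α) : Prop :=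
  g ∈ O.toMatroid.E ∧ f ∈ O.toMatroid.E ∧ g ≠ f ∧
    ¬ O.toMatroid.IsLoop g ∧ ¬ O.toMatroid.IsColoop f

/-- `(O, g, f)` is a Euclidean oriented matroid program: its directed cocircuit graph `G_f` has no
directed cycle. -/
def IsEuclideanProgram (O : OrientedMatroid α) (g f : α) : Prop :=
  O.IsProgram g f ∧ ¬ ∃ n P, O.IsDirectedCycle g f n P

/-- An element is in general position if it lies in no non-spanning circuit. -/
def InGeneralPosition (O : OrientedMatroid α) (f : α) : Prop :=
  f ∈ O.toMatroid.E ∧ ∀ C, O.toMatroid.IsCircuit C → f ∈ C → O.toMatroid.Spanning C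

open Classical in
/-- The localization of the positive lexicographic extension `O[e₁⁺, …, e_k⁺]`: `σ(Y) = Y_{e_i}`
for the first `i` with `Y_{e_i} ≠ 0`, and `σ(Y) = 0` if there is no such `i`. -/
noncomputable def lexLocalization {k : ℕ} (e : Fin k → α) (Y : SignVector α) : SignType :=
  if h : ∃ i, Y (e i) ≠ 0 then Y (e (Fin.find (fun i => Y (e i) ≠ 0) h)) else 0

/-- `O'` is the single-element extension `O ∪ p` with localization `σ`: `p` is a new element, the
underlying matroid of `O'` with `p` deleted is that of `O`, and for every cocircuit `Y` of `O` the
sign vector `(Y, σ(Y))` is a cocircuit of `O'`. (The last two conditions say that deleting `p` from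
`O'` gives the oriented matroid `O`, and that `σ` is the localization of the extension.) -/
def IsExtension (O O' : OrientedMatroid α) (p : α) (σ : SignVector α → SignType) : Prop :=
  p ∉ O.toMatroid.E ∧ O'.toMatroid.E = insert p O.toMatroid.E ∧
    O'.toMatroid.delete {p} = O.toMatroid ∧
    ∀ Y ∈ O.cocircuits, ∃ X ∈ O'.cocircuits, X p = σ Y ∧ ∀ x, x ≠ p → X x = Y x

/-- `O' = O ∪ p` is the positive lexicographic extension `O[e₁⁺, …, e_k⁺]`. -/
def IsLexExtension (O O' : OrientedMatroid α) (p : α) {k : ℕ} (e : Fin k → α) : Prop :=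
  O.IsExtension O' p (lexLocalization e)

/-- The smallest `l ∈ {1, …, k}` with `f ∈ cl {e₁, …, e_l}`, and `k + 1` if there is none. Here
`e₁, …, e_k` are the values `e 0, …, e (k-1)`. -/
noncomputable def spanIndex (O : OrientedMatroid α) {k : ℕ} (e : Fin k → α) (f : α) : ℕ :=
  sInf {l | (1 ≤ l ∧ l ≤ k ∧ f ∈ O.toMatroid.closure (e '' {j | j.val < l})) ∨ l = k + 1}

end OrientedMatroid

/-!
Let `P` be a directed cycle of `(O', p, f)`. Every vertex of it is `(Q, +)` for a cocircuit `Q` of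
`O` whose first nonzero entry along `e₁, …, e_k` is positive.

Directions of edges are computed by one identity, `IsElimination.apply_eq_neg_mul`. Let `X`, `Y` be
comodular with `X_g = Y_g = +` and `X_f = Y_f = c ≠ 0`, and let `Z` and `F` arise from `-X` and `Y`
by eliminating `g` and `f` respectively. Then `Z_f = -c F_g`. For an edge of the extension it gives
`Z_f = -c σ(F)`, with `F` a cocircuit of `O` and `σ` the lexicographic localization
(`IsExtension.apply_eq_neg_mul`). The underlying fact is that a cocircuit through a coline is
determined up to sign by one further zero (`Comodular.eq_or_eq_neg`).

The sign at `f` does not decrease along the cycle (`IsGraphEdge.apply_le`), so it is a constant `c`.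
If `c = 0`, then `f` vanishes on all eliminations and all edges are undirected. So let `c ≠ 0`. By
`lexLocalization_eq_neg_one`, an edge along which the leading index increases is directed forwards
only for `c = +`, and one along which it decreases only for `c = -`. Hence all vertices have the
same leading index `i`, and the cycle is a closed path in the program
`(O / {e₁, …, e_{i-1}}, e_i, f)`.

It remains to see that all the cocircuits `F` belonging to the edges vanish at `e₁, …, e_k`, for
then `σ(F) = 0` and all edges are undirected. This is shown for `e_j` by induction on `j`. If all `F`
vanish at the earlier elements, then `-c F_{e_j} ≥ 0` for all of them. For `j < i` the vertices
already vanish at `e_j`. For `j = i` the identity turns this into a weakly directed closed path in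
`(O / {e₁, …, e_{i-1}}, e_i, f)`, which has only undirected edges if `i < l` as the program is
Euclidean, and if `i = l` as `f` is spanned by `e₁, …, e_i`. For `j > i` the cocircuit `F` vanishes
at `e_i`, so it is also the elimination of `e_i`, and the closed path is weakly directed, forwards
or backwards according to `c`, in the program `(O / {e₁, …, e_{i-1}}, e_i, e_j)`. That program is
Euclidean by the second hypothesis: `f` and `e_i` are parallel over a coline, so `f = e_i` or `f` is
not in general position (`not_inGeneralPosition`).
-/

/-! ### Flats, cocircuits and minors of matroids -/

namespace Matroid

variable {α : Type*} {M : Matroid α}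

lemma IsCocircuit.isFlat_compl {K : Set α} (hK : M.IsCocircuit K) : M.IsFlat (M.E \ K) := by
  rw [isFlat_iff_closure_eq]
  refine Subset.antisymm (fun x hx => ?_) (M.subset_closure _ sdiff_subset)
  by_contra hxn
  obtain ⟨C, hCs, hC, hxC⟩ := (mem_closure_iff_exists_isCircuit hxn).1 hx
  have hxK : x ∈ K := by
    by_contra h
    exact hxn ⟨mem_ground_of_mem_closure hx, h⟩
  refine hC.inter_isCocircuit_ne_singleton hK (e := x) (Subset.antisymm ?_ ?_)
  · rintro y ⟨hyC, hyK⟩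
    rcases hCs hyC with rfl | hy
    · rfl
    · exact absurd hyK hy.2
  · rintro y rfl
    exact ⟨hxC, hxK⟩

/-- In the lattice of flats above a coline `L`, a proper flat `F` that contains a point `x ∉ L` is
the smallest flat containing `L` and `x`: a longer chain would raise the rank above that of `M`. -/
lemma IsFlat.subset_of_coline [M.RankFinite] {L F G : Set α} {x : α} (hL : M.IsFlat L)
    (hr : M.eRk L + 2 = M.eRank) (hF : M.IsFlat F) (hG : M.IsFlat G) (hLF : L ⊆ F) (hLG : L ⊆ G)
    (hxF : x ∈ F) (hxG : x ∈ G) (hxL : x ∉ L) (hFE : F ≠ M.E) : F ⊆ G := by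
  intro y hyF
  by_contra hyG
  obtain ⟨w, hwE, hwF⟩ : ∃ w ∈ M.E, w ∉ F := by
    by_contra! h
    exact hFE (Subset.antisymm hF.subset_ground h)
  have h1 : M.eRk (insert x L) = M.eRk L + 1 :=
    eRk_insert_eq_add_one ⟨hF.subset_ground hxF, by rwa [hL.closure]⟩
  have h2 : M.eRk (insert y (insert x L)) = M.eRk (insert x L) + 1 := by
    refine eRk_insert_eq_add_one ⟨hF.subset_ground hyF, fun h => hyG ?_⟩
    rw [← hG.closure]
    exact M.closure_subset_closure (insert_subset hxG hLG) h
  have h3 : M.eRk (insert w (insert y (insert x L))) = M.eRk (insert y (insert x L)) + 1 := by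
    refine eRk_insert_eq_add_one ⟨hwE, fun h => hwF ?_⟩
    rw [← hF.closure]
    exact M.closure_subset_closure (insert_subset hyF (insert_subset hxF hLF)) h
  have h4 := M.eRk_le_eRank (insert w (insert y (insert x L)))
  have htop : M.eRk L ≠ ⊤ := fun h => by
    rw [h, top_add] at hr
    exact (M.eRank_ne_top_iff.2 inferInstance) hr.symm
  rw [h3, h2, h1, ← hr] at h4
  lift M.eRk L to ℕ using htop with r
  norm_cast at h4
  omega

lemma Indep.eRk_contract_sdiff_add_encard {A X : Set α} (hA : M.Indep A) (hAX : A ⊆ X)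
    (hX : X ⊆ M.E) : (M ／ A).eRk (X \ A) + A.encard = M.eRk X := by
  obtain ⟨I, hI, hAI⟩ := hA.subset_isBasis_of_subset hAX hX
  rw [← (hI.isBasis'.contract_isBasis'_sdiff_sdiff_of_subset hAI).encard_eq_eRk,
    ← hI.encard_eq_eRk, Set.encard_sdiff_add_encard_of_subset hAI]

lemma IsFlat.contract_sdiff {A F : Set α} (hF : M.IsFlat F) (hAF : A ⊆ F) :
    (M ／ A).IsFlat (F \ A) := by
  rw [isFlat_iff_closure_eq, contract_closure_eq, sdiff_union_of_subset hAF, hF.closure]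

lemma eRank_delete_singleton_of_not_isColoop {p : α} (hp : ¬ M.IsColoop p) :
    (M ＼ {p}).eRank = M.eRank := by
  rw [isColoop_iff_sdiff_not_spanning, not_not] at hp
  rw [delete_eq_restrict, eRank_restrict, hp.eRk_eq]

end Matroid

/-! ### Cocircuits on a coline -/

namespace OrientedMatroid

variable {α : Type*} {O : OrientedMatroid α} {f g : α} {X Y Z F : SignVector α}

lemma matroid_finite (O : OrientedMatroid α) : O.toMatroid.Finite := ⟨O.finite_ground⟩

lemma isCocircuit_support (hX : X ∈ O.cocircuits) :
    O.toMatroid.IsCocircuit (Function.support X) := (O.isCocircuit_iff _).2 ⟨X, hX, rfl⟩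

lemma mem_ground_of_ne_zero (hX : X ∈ O.cocircuits) {x : α} (hx : X x ≠ 0) :
    x ∈ O.toMatroid.E := (isCocircuit_support hX).subset_ground hx

lemma zeroSet_eq (O : OrientedMatroid α) (X : SignVector α) :
    O.zeroSet X = O.toMatroid.E \ Function.support X := by
  ext x
  simp [zeroSet]

lemma isFlat_zeroSet (hX : X ∈ O.cocircuits) : O.toMatroid.IsFlat (O.zeroSet X) := by
  rw [zeroSet_eq]
  exact (isCocircuit_support hX).isFlat_compl

lemma zeroSet_ne_ground (hX : X ∈ O.cocircuits) : O.zeroSet X ≠ O.toMatroid.E := by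
  obtain ⟨x, hx⟩ := (isCocircuit_support hX).nonempty
  intro h
  exact hx (h ▸ mem_ground_of_ne_zero hX hx : x ∈ O.zeroSet X).2

lemma eq_zero_of_mem_closure (hX : X ∈ O.cocircuits) {A : Set α} (hAE : A ⊆ O.toMatroid.E)
    (hA : ∀ a ∈ A, X a = 0) (hf : f ∈ O.toMatroid.closure A) : X f = 0 := by
  have hs : A ⊆ O.zeroSet X := fun a ha => ⟨hAE ha, hA a ha⟩
  have h := O.toMatroid.closure_subset_closure hs hf
  rw [(isFlat_zeroSet hX).closure] at h
  exact h.2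

lemma eq_or_eq_neg_of_forall (hX : X ∈ O.cocircuits) (hY : Y ∈ O.cocircuits)
    (h : ∀ x, Y x = 0 → X x = 0) : X = Y ∨ X = -Y :=
  O.eq_or_eq_neg X hX Y hY <| (isCocircuit_support hX).isCircuit.eq_of_subset_isCircuit
    (isCocircuit_support hY).isCircuit fun x hx hy => hx (h x hy)

lemma Conformal.symm (h : Conformal X Y) : Conformal Y X := fun x hy hx => (h x hx hy).symm

lemma Comodular.symm (h : O.Comodular X Y) : O.Comodular Y X := by
  unfold Comodular
  rw [inter_comm]
  exact h

lemma IsGraphEdge.symm (h : O.IsGraphEdge g X Y) : O.IsGraphEdge g Y X :=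
  ⟨h.2.1, h.1, h.2.2.1.symm, h.2.2.2.symm⟩

lemma IsElimination.neg_symm (h : O.IsElimination g (-X) Y Z) :
    O.IsElimination g (-Y) X (-Z) := by
  refine ⟨O.neg_mem _ h.1, by simp [h.2.1], fun x hx => ?_⟩
  rcases h.2.2 x (by simpa using hx) with h' | h' <;> simp [h']

lemma IsElimination.apply_eq_zero (h : O.IsElimination g (-X) Y Z) {x : α} (hX : X x = 0)
    (hY : Y x = 0) : Z x = 0 := by
  by_contra hz
  rcases h.2.2 x hz with h' | h' <;> simp_all

lemma IsElimination.change (h : O.IsElimination g (-X) Y Z) (hf : Z f = 0) :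
    O.IsElimination f (-X) Y Z := ⟨h.1, hf, h.2.2⟩

/-- A cocircuit through a coline is determined up to sign by one further zero. -/
lemma Comodular.eq_or_eq_neg (h : O.Comodular X Y) (hZ : Z ∈ O.cocircuits) (hF : F ∈ O.cocircuits)
    (hZL : ∀ x, X x = 0 → Y x = 0 → Z x = 0) (hFL : ∀ x, X x = 0 → Y x = 0 → F x = 0)
    {x : α} (hx : x ∈ O.toMatroid.E) (hxL : ¬ (X x = 0 ∧ Y x = 0)) (hZx : Z x = 0)
    (hFx : F x = 0) : Z = F ∨ Z = -F := by
  have := O.matroid_finite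
  have hs : O.zeroSet F ⊆ O.zeroSet Z :=
    h.1.subset_of_coline h.2 (isFlat_zeroSet hF) (isFlat_zeroSet hZ)
      (fun a ha => ⟨ha.1.1, hFL a ha.1.2 ha.2.2⟩) (fun a ha => ⟨ha.1.1, hZL a ha.1.2 ha.2.2⟩)
      ⟨hx, hFx⟩ ⟨hx, hZx⟩ (fun hL => hxL ⟨hL.1.2, hL.2.2⟩) (zeroSet_ne_ground hF)
  refine eq_or_eq_neg_of_forall hZ hF fun a ha => ?_
  by_contra hza
  exact hza (hs ⟨mem_ground_of_ne_zero hZ hza, ha⟩).2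

/-- Eliminating `g` between `-X` and `Y` has at most one outcome: two outcomes agree up to sign,
and opposite outcomes would be supported in the intersection of the supports of `X` and `Y`. -/
lemma IsElimination.unique (hX : X ∈ O.cocircuits) (h : O.Comodular X Y)
    (hg : X g ≠ 0) (hZ : O.IsElimination g (-X) Y Z) (hF : O.IsElimination g (-X) Y F) :
    Z = F := by
  rcases h.eq_or_eq_neg hZ.1 hF.1 (fun x => hZ.apply_eq_zero) (fun x => hF.apply_eq_zero)
    (mem_ground_of_ne_zero hX hg) (fun h => hg h.1) hZ.2.1 hF.2.1 with h' | rfl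
  · exact h'
  · exfalso
    have hsupp : ∀ x, X x = 0 → F x = 0 := by
      intro x hx
      by_contra hFx
      have h1 := hF.2.2 x hFx
      have h2 := hZ.2.2 x (by simpa using hFx)
      simp only [Pi.neg_apply, hx, neg_zero, hFx, SignType.neg_eq_zero_iff, false_or] at h1 h2
      rw [← h1] at h2
      exact hFx (SignType.neg_eq_self_iff.1 h2)
    rcases eq_or_eq_neg_of_forall hF.1 hX hsupp with h' | h' <;>
      exact hg (by simpa [h'] using hF.2.1)

/-- The comparison behind the whole argument. If `X` and `Y` have the same sign `c` at `f`, then the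
sign at `f` after eliminating `g` is, up to the factor `-c`, the sign at `g` after eliminating `f`.
On the arc of the coline from `-X` to `Y`, both say in which order `f` and `g` vanish. -/
lemma IsElimination.apply_eq_neg_mul (hX : X ∈ O.cocircuits) (hY : Y ∈ O.cocircuits)
    (h : O.Comodular X Y) (hXg : X g = 1) (hYg : Y g = 1) {c : SignType} (hc : c ≠ 0)
    (hXf : X f = c) (hYf : Y f = c) (hF : O.IsElimination f (-X) Y F)
    (hZ : O.IsElimination g (-X) Y Z) : Z f = -c * F g := by
  have hXg0 : X g ≠ 0 := by simp [hXg]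
  have hXf0 : X f ≠ 0 := hXf ▸ hc
  -- `F` and `Z` have a common zero outside the coline only if they agree up to sign.
  have key : Z f = 0 ∨ F g = 0 → Z f = 0 ∧ F g = 0 := by
    intro h0
    have : Z = F ∨ Z = -F := by
      rcases h0 with h0 | h0
      · exact h.eq_or_eq_neg hZ.1 hF.1 (fun x => hZ.apply_eq_zero) (fun x => hF.apply_eq_zero)
          (mem_ground_of_ne_zero hX hXf0) (fun h => hXf0 h.1) h0 hF.2.1
      · exact h.eq_or_eq_neg hZ.1 hF.1 (fun x => hZ.apply_eq_zero) (fun x => hF.apply_eq_zero)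
          (mem_ground_of_ne_zero hX hXg0) (fun h => hXg0 h.1) hZ.2.1 h0
    rcases this with rfl | rfl
    · exact ⟨hF.2.1, hZ.2.1⟩
    · exact ⟨by simp [hF.2.1], by simpa using hZ.2.1⟩
  by_cases hFg : F g = 0
  · rw [hFg, mul_zero, (key (.inr hFg)).1]
  have hZf : Z f ≠ 0 := fun h0 => hFg (key (.inl h0)).2
  -- Otherwise `Z` also arises by eliminating `g` between `F` and one of `-X`, `Y`.
  rcases SignType.trichotomy (F g) with hFg' | hFg' | hFg'
  · obtain ⟨W, hW, hWg, hWs⟩ := O.elimination F hF.1 Y hY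
      (fun e => by
        have := congrFun e f
        rw [hF.2.1, Pi.neg_apply, hYf] at this
        exact hc (SignType.neg_eq_zero_iff.1 this.symm)) g hFg (by rw [hFg', hYg])
    have hWE : O.IsElimination g (-X) Y W := ⟨hW, hWg, fun x hx => by
      rcases hWs x hx with h' | h'
      · rw [h']
        exact hF.2.2 x (h' ▸ hx)
      · exact .inr h'⟩
    obtain rfl := hZ.unique hX h hXg0 hWE
    rcases hWs f hZf with h' | h'
    · exact absurd (h'.trans hF.2.1) hZf
    · rw [h', hYf, hFg', neg_mul_neg, mul_one]
  · exact absurd hFg' hFg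
  · obtain ⟨W, hW, hWg, hWs⟩ := O.elimination (-X) (O.neg_mem X hX) F hF.1
      (fun e => by
        have := congrFun e f
        simp only [Pi.neg_apply, hXf, hF.2.1, neg_zero] at this
        exact hc (SignType.neg_eq_zero_iff.1 this)) g (by simp [hXg])
        (by rw [hFg', Pi.neg_apply, hXg])
    have hWE : O.IsElimination g (-X) Y W := ⟨hW, hWg, fun x hx => by
      rcases hWs x hx with h' | h'
      · exact .inl h'
      · rw [h']
        exact hF.2.2 x (h' ▸ hx)⟩
    obtain rfl := hZ.unique hX h hXg0 hWE
    rcases hWs f hZf with h' | h'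
    · rw [h', Pi.neg_apply, hXf, hFg', mul_one]
    · exact absurd (h'.trans hF.2.1) hZf

lemma IsElimination.ne (hX : X ∈ O.cocircuits) (hg : X g ≠ 0)
    (hZ : O.IsElimination g (-X) Y Z) : X ≠ Y := by
  rintro rfl
  rcases eq_or_eq_neg_of_forall hZ.1 hX (fun x hx => hZ.apply_eq_zero hx hx) with h' | h' <;>
    exact hg (by simpa [h'] using hZ.2.1)

lemma exists_isElimination (hX : X ∈ O.cocircuits) (hY : Y ∈ O.cocircuits) (hne : X ≠ Y)
    (hg : X g ≠ 0) (hXY : X g = Y g) : ∃ Z, O.IsElimination g (-X) Y Z := by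
  obtain ⟨Z, hZ⟩ := O.elimination (-X) (O.neg_mem X hX) Y hY (fun e => hne (neg_injective e)) g
    (by simpa using hg) (by simp [hXY])
  exact ⟨Z, hZ⟩

/-- The sign at `f` never decreases along an edge that is undirected or directed forwards. -/
lemma IsGraphEdge.apply_le (h : O.IsGraphEdge g X Y) (hZ : O.IsElimination g (-X) Y Z)
    (h0 : 0 ≤ Z f) : X f ≤ Y f := by
  obtain ⟨⟨hX, hXg⟩, ⟨hY, hYg⟩, hcom, hconf⟩ := h
  by_contra hlt
  have hne : ¬ (X f = 0 ∧ Y f = 0) := fun h => hlt (by rw [h.1, h.2])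
  -- By conformality one of `X f`, `Y f` is zero, so `Z f` is negative or zero.
  have hZf : Z f = 0 := by
    by_contra hz
    have h1 := hZ.2.2 f hz
    have h2 := hconf f
    rw [Pi.neg_apply] at h1
    generalize Z f = z at *
    generalize X f = a at *
    generalize Y f = b at *
    revert z a b
    decide
  have hfE : f ∈ O.toMatroid.E := by
    rcases not_and_or.1 hne with h' | h'
    exacts [mem_ground_of_ne_zero hX h', mem_ground_of_ne_zero hY h']
  have hzero : X f = 0 ∨ Y f = 0 := by
    by_contra! h'
    exact hlt (hconf f h'.1 h'.2).le
  rcases hzero with h' | h'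
  · rcases hcom.eq_or_eq_neg hZ.1 hX (fun x => hZ.apply_eq_zero) (fun x hx _ => hx) hfE hne hZf h'
      with rfl | rfl <;> simpa [hXg] using hZ.2.1
  · rcases hcom.eq_or_eq_neg hZ.1 hY (fun x => hZ.apply_eq_zero) (fun x _ hx => hx) hfE hne hZf h'
      with rfl | rfl <;> simpa [hYg] using hZ.2.1

/-- If eliminating `f` between `-X` and `Y` makes another element `g` with `X g ≠ 0` vanish, then
`f` and `g` are parallel over the coline of `X` and `Y`, and `f` lies in a circuit inside the
hyperplane spanned by them. -/
lemma not_inGeneralPosition (hX : X ∈ O.cocircuits) (h : O.Comodular X Y) (hfg : f ≠ g)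
    (hXf : X f ≠ 0) (hXg : X g ≠ 0) (hF : O.IsElimination f (-X) Y F) (hFg : F g = 0) :
    ¬ O.InGeneralPosition f := by
  rintro ⟨hfE, hgen⟩
  have := O.matroid_finite
  set L := O.zeroSet X ∩ O.zeroSet Y with hL
  have hgE := mem_ground_of_ne_zero hX hXg
  have hLF : L ⊆ O.zeroSet F := fun a ha => ⟨ha.1.1, hF.apply_eq_zero ha.1.2 ha.2.2⟩
  have hgL : insert g L ⊆ O.toMatroid.E := insert_subset hgE fun a ha => ha.1.1
  have hsub := O.toMatroid.subset_closure (insert g L) hgL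
  have hf : f ∈ O.toMatroid.closure (insert g L) :=
    h.1.subset_of_coline h.2 (isFlat_zeroSet hF.1) (O.toMatroid.isFlat_closure _) hLF
      ((subset_insert _ _).trans hsub) ⟨hgE, hFg⟩ (hsub (mem_insert _ _)) (fun hx => hXg hx.1.2)
      (zeroSet_ne_ground hF.1) ⟨hfE, hF.2.1⟩
  have hfn : f ∉ insert g L := by
    rintro (h' | h')
    exacts [hfg h', hXf h'.1.2]
  obtain ⟨C, hCs, hC, hfC⟩ := (Matroid.mem_closure_iff_exists_isCircuit hfn).1 hf
  have hCF : C ⊆ O.zeroSet F :=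
    hCs.trans (insert_subset ⟨hfE, hF.2.1⟩ (insert_subset ⟨hgE, hFg⟩ hLF))
  have hcl := O.toMatroid.closure_subset_closure hCF
  rw [(isFlat_zeroSet hF.1).closure, (hgen C hC hfC).closure_eq] at hcl
  exact zeroSet_ne_ground hF.1 (Subset.antisymm (isFlat_zeroSet hF.1).subset_ground hcl)

/-! ### Contractions and cycles -/

lemma Comodular.contract {A : Set α} (hA : O.toMatroid.Indep A) (h : O.Comodular X Y)
    (hXA : ∀ a ∈ A, X a = 0) (hYA : ∀ a ∈ A, Y a = 0) : (O.contract A).Comodular X Y := by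
  have := O.matroid_finite
  set L := O.zeroSet X ∩ O.zeroSet Y with hL
  have hAL : A ⊆ L := fun a ha =>
    ⟨⟨hA.subset_ground ha, hXA a ha⟩, ⟨hA.subset_ground ha, hYA a ha⟩⟩
  have hLE : L ⊆ O.toMatroid.E := fun a ha => ha.1.1
  have hset : (O.contract A).zeroSet X ∩ (O.contract A).zeroSet Y = L \ A := by
    ext x
    simp only [zeroSet, OrientedMatroid.contract, Matroid.contract_ground, hL, mem_inter_iff,
      mem_sdiff, mem_ofPred_eq]
    tauto
  refine ⟨hset ▸ h.1.contract_sdiff hAL, ?_⟩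
  rw [hset]
  have h1 := hA.eRk_contract_sdiff_add_encard hAL hLE
  have h2 := hA.eRk_contract_sdiff_add_encard hA.subset_ground subset_rfl
  have h3 : (O.toMatroid.contract A).eRank = (O.toMatroid.contract A).eRk (O.toMatroid.E \ A) :=
    Matroid.eRank_def _
  have h4 := h.2
  rw [← h1, ← O.toMatroid.eRk_ground, ← h2, add_right_comm] at h4
  change (O.toMatroid.contract A).eRk (L \ A) + 2 = (O.toMatroid.contract A).eRank
  rw [h3]
  exact (WithTop.add_right_inj
    (Set.encard_ne_top_iff.2 (O.finite_ground.subset hA.subset_ground))).1 h4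

lemma eq_of_monotone_cycle {β : Type*} [PartialOrder β] {a : ℕ → β} {n : ℕ}
    (h : ∀ m < n, a m ≤ a (m + 1)) (hn : a n = a 0) : ∀ m ≤ n, a m = a 0 := by
  have h1 : ∀ m ≤ n, a 0 ≤ a m := by
    intro m
    induction m with
    | zero => exact fun _ => le_rfl
    | succ m ih => exact fun hm => (ih (by omega)).trans (h m (by omega))
  have h2 : ∀ d ≤ n, a (n - d) ≤ a n := by
    intro d
    induction d with
    | zero => exact fun _ => le_rfl
    | succ d ih =>
      intro hd
      have := h (n - (d + 1)) (by omega)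
      rw [show n - (d + 1) + 1 = n - d by omega] at this
      exact this.trans (ih (by omega))
  intro m hm
  have := h2 (n - m) (by omega)
  rw [show n - (n - m) = m by omega, hn] at this
  exact le_antisymm this (h1 m hm)

/-- In a Euclidean program, a closed path all of whose edges are directed weakly in the same sense,
forwards for `s = 1` and backwards for `s = -1`, has undirected edges only. -/
lemma IsEuclideanProgram.apply_eq_zero (hE : O.IsEuclideanProgram g f) {n : ℕ}
    {Q Z : ℕ → SignVector α} (hcl : Q n = Q 0)
    (hinj : ∀ i < n, ∀ j < n, Q i = Q j → i = j)
    (hedge : ∀ i < n, O.IsGraphEdge g (Q i) (Q (i + 1)))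
    (hZ : ∀ i < n, O.IsElimination g (-Q i) (Q (i + 1)) (Z i)) {s : SignType} (hs : s ≠ 0)
    (hsZ : ∀ i < n, 0 ≤ s * Z i f) : ∀ i < n, Z i f = 0 := by
  -- The forward case; the backward case is the forward case of the reversed path.
  have forward : ∀ Q Z : ℕ → SignVector α, Q n = Q 0 →
      (∀ i < n, ∀ j < n, Q i = Q j → i = j) →
      (∀ i < n, O.IsGraphEdge g (Q i) (Q (i + 1))) →
      (∀ i < n, O.IsElimination g (-Q i) (Q (i + 1)) (Z i)) → (∀ i < n, 0 ≤ Z i f) →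
      ∀ i < n, Z i f = 0 := by
    intro Q Z hcl hinj hedge hZ hsZ i hi
    by_contra hne
    refine hE.2 ⟨n, Q, hcl, hinj, hedge, fun j hj => ?_, i, hi, ?_⟩
    · rcases SignType.trichotomy (Z j f) with h | h | h
      · exact absurd (hsZ j hj) (by rw [h]; decide)
      · exact .inr ⟨Z j, hZ j hj, h⟩
      · exact .inl ⟨Z j, hZ j hj, h⟩
    · rintro ⟨W, hW, hWf⟩
      have he := hedge i hi
      rw [← (hZ i hi).unique he.1.1 he.2.2.1 (by simp [he.1.2]) hW] at hWf
      exact hne hWf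
  rcases SignType.trichotomy s with rfl | rfl | rfl
  · have h := forward (fun m => Q (n - m)) (fun m => -Z (n - 1 - m)) (by simp [hcl])
      (fun i hi j hj hij => by
        rcases Nat.eq_zero_or_pos i with rfl | hi0 <;> rcases Nat.eq_zero_or_pos j with rfl | hj0
        · rfl
        · rw [Nat.sub_zero, hcl] at hij
          have := hinj 0 (by omega) (n - j) (by omega) hij
          omega
        · rw [Nat.sub_zero, hcl] at hij
          have := hinj (n - i) (by omega) 0 (by omega) hij
          omega
        · have := hinj (n - i) (by omega) (n - j) (by omega) hij
          omega)
      (fun i hi => by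
        have := hedge (n - 1 - i) (by omega)
        rw [show n - 1 - i + 1 = n - i by omega] at this
        simpa only [show n - (i + 1) = n - 1 - i by omega] using this.symm)
      (fun i hi => by
        have := (hZ (n - 1 - i) (by omega)).neg_symm
        rw [show n - 1 - i + 1 = n - i by omega] at this
        simpa only [show n - (i + 1) = n - 1 - i by omega] using this)
      (fun i hi => by simpa using hsZ (n - 1 - i) (by omega))
    intro i hi
    have := h (n - 1 - i) (by omega)
    rw [show n - 1 - (n - 1 - i) = i by omega] at this
    simpa using this
  · exact absurd rfl hs
  · exact forward Q Z hcl hinj hedge hZ (by simpa using hsZ)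

/-! ### The lexicographic localization -/

variable {k : ℕ} {e : Fin k → α}

lemma lexLocalization_of_forall (h : ∀ i, Y (e i) = 0) : lexLocalization e Y = 0 := by
  rw [lexLocalization, dif_neg]
  rintro ⟨i, hi⟩
  exact hi (h i)

lemma lexLocalization_eq {i : Fin k} (h0 : ∀ j < i, Y (e j) = 0) (hi : Y (e i) ≠ 0) :
    lexLocalization e Y = Y (e i) := by
  classical
  have h : ∃ i, Y (e i) ≠ 0 := ⟨i, hi⟩
  have hfind : Fin.find (fun i => Y (e i) ≠ 0) h = i :=
    (Fin.find_eq_iff h).2 ⟨hi, fun j hj => not_not.2 (h0 j hj)⟩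
  rw [lexLocalization, dif_pos h]
  convert rfl using 3
  exact hfind.symm

lemma exists_of_lexLocalization_ne_zero (h : lexLocalization e Y ≠ 0) :
    ∃ i, (∀ j < i, Y (e j) = 0) ∧ Y (e i) = lexLocalization e Y := by
  classical
  by_cases hex : ∃ i, Y (e i) ≠ 0
  · have h0 : ∀ j < Fin.find (fun i => Y (e i) ≠ 0) hex, Y (e j) = 0 := fun j hj =>
      not_not.1 (Fin.find_min hex hj)
    exact ⟨_, h0, (lexLocalization_eq h0 (Fin.find_spec hex)).symm⟩
  · push Not at hex
    exact absurd (lexLocalization_of_forall hex) h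

lemma lexLocalization_ne_zero {i : Fin k} (hi : Y (e i) ≠ 0) : lexLocalization e Y ≠ 0 := by
  classical
  have h : ∃ i, Y (e i) ≠ 0 := ⟨i, hi⟩
  rw [lexLocalization_eq (fun j hj => not_not.1 (Fin.find_min h hj)) (Fin.find_spec h)]
  exact Fin.find_spec h

lemma lexLocalization_neg (e : Fin k → α) (Y : SignVector α) :
    lexLocalization e (-Y) = -lexLocalization e Y := by
  by_cases h : ∀ i, Y (e i) = 0
  · rw [lexLocalization_of_forall h, lexLocalization_of_forall (by simpa using h), neg_zero]
  · classical
    push Not at h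
    have h0 : ∀ j < Fin.find (fun i => Y (e i) ≠ 0) h, Y (e j) = 0 := fun j hj =>
      not_not.1 (Fin.find_min h hj)
    have hi := Fin.find_spec h
    rw [lexLocalization_eq h0 hi]
    exact lexLocalization_eq (fun j hj => by simp [h0 j hj]) (by simpa using hi)

/-! ### Single-element extensions -/

section Extension

variable {O' : OrientedMatroid α} {p : α} {σ : SignVector α → SignType}

open Function (update)

open Classical in
/-- The sign vector that arises from `X` by forgetting the sign at `p`. -/
noncomputable def forget (p : α) (X : SignVector α) : SignVector α := update X p 0

lemma forget_apply {x : α} (hx : x ≠ p) : forget p X x = X x := by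
  simp [forget, hx]

lemma forget_self : forget p X p = 0 := by
  simp [forget]

lemma IsExtension.ne_of_mem (h : O.IsExtension O' p σ) {x : α} (hx : x ∈ O.toMatroid.E) :
    x ≠ p := by
  rintro rfl
  exact h.1 hx

lemma IsExtension.apply_eq_zero (h : O.IsExtension O' p σ) (hY : Y ∈ O.cocircuits) :
    Y p = 0 := by
  by_contra hp
  exact h.1 (mem_ground_of_ne_zero hY hp)

lemma IsExtension.not_isColoop (h : O.IsExtension O' p σ) (hY : Y ∈ O.cocircuits)
    (hσ : σ Y ≠ 0) : ¬ O'.toMatroid.IsColoop p := by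
  rw [← Matroid.singleton_isCocircuit]
  intro hp
  obtain ⟨X, hX, hXp, hXY⟩ := h.2.2.2 Y hY
  have hsub : {p} ⊆ Function.support X := by
    rw [singleton_subset_iff, Function.mem_support, hXp]
    exact hσ
  have heq := hp.isCircuit.eq_of_subset_isCircuit (isCocircuit_support hX).isCircuit hsub
  obtain ⟨x, hx⟩ := (isCocircuit_support hY).nonempty
  have hxp := h.ne_of_mem (mem_ground_of_ne_zero hY hx)
  have : x ∈ ({p} : Set α) := by
    rw [heq, Function.mem_support, hXY x hxp]
    exact hx
  exact hxp this

/-- A cocircuit of the extension that does not vanish at the new element `p` comes from a cocircuit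
of the original oriented matroid, and its sign at `p` is prescribed by the localization. -/
lemma IsExtension.forget_mem (h : O.IsExtension O' p σ) (hneg : ∀ Y, σ (-Y) = -σ Y)
    (hp : ¬ O'.toMatroid.IsColoop p) (hX : X ∈ O'.cocircuits) (hXp : X p ≠ 0) :
    forget p X ∈ O.cocircuits ∧ σ (forget p X) = X p := by
  have hK := isCocircuit_support hX
  have hss : {p} ⊂ Function.support X := by
    refine (singleton_subset_iff.2 hXp).ssubset_of_ne fun heq => hp ?_
    rw [← Matroid.singleton_isCocircuit, heq]
    exact hK
  have hK' := hK.delete_isCocircuit hss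
  rw [h.2.2.1] at hK'
  obtain ⟨Y, hY, hYs⟩ := (O.isCocircuit_iff _).1 hK'
  obtain ⟨W, hW, hWp, hWY⟩ := h.2.2.2 Y hY
  have hYp := h.apply_eq_zero hY
  have hWX : W = X ∨ W = -X := by
    refine eq_or_eq_neg_of_forall hW hX fun x hx => ?_
    have hxp : x ≠ p := by
      rintro rfl
      exact hXp hx
    rw [hWY x hxp]
    by_contra hYx
    exact (hYs ▸ hYx : x ∈ Function.support X \ {p}).1 hx
  have hval : ∀ V : SignVector α, V p = 0 → (∀ x, x ≠ p → V x = X x) → forget p X = V := by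
    intro V hVp hV
    funext x
    by_cases hx : x = p
    · rw [hx, forget_self, hVp]
    · rw [forget_apply hx, hV x hx]
  rcases hWX with rfl | rfl
  · rw [hval Y hYp fun x hx => (hWY x hx).symm]
    exact ⟨hY, hWp.symm⟩
  · rw [hval (-Y) (by simp [hYp]) fun x hx => by
      rw [Pi.neg_apply, ← hWY x hx, Pi.neg_apply, neg_neg]]
    refine ⟨O.neg_mem Y hY, ?_⟩
    rw [hneg, ← hWp, Pi.neg_apply, neg_neg]

lemma IsExtension.comodular_forget (h : O.IsExtension O' p σ) (hp : ¬ O'.toMatroid.IsColoop p)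
    (hXp : X p ≠ 0) (hXY : O'.Comodular X Y) : O.Comodular (forget p X) (forget p Y) := by
  have hE : O.toMatroid.E = O'.toMatroid.E \ {p} := by
    rw [← h.2.2.1, Matroid.delete_ground]
  have hset : O.zeroSet (forget p X) ∩ O.zeroSet (forget p Y) =
      O'.zeroSet X ∩ O'.zeroSet Y := by
    ext x
    by_cases hx : x = p
    · subst hx
      simp [zeroSet, hE, hXp]
    · simp [zeroSet, hE, hx, forget_apply hx]
  have hpL : p ∉ O'.zeroSet X ∩ O'.zeroSet Y := fun hL => hXp hL.1.2
  have hdis : Disjoint (O'.zeroSet X ∩ O'.zeroSet Y) {p} := disjoint_singleton_right.2 hpL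
  refine ⟨?_, ?_⟩
  · rw [hset, ← h.2.2.1, Matroid.isFlat_iff_closure_eq,
      Matroid.delete_closure_eq_of_disjoint _ hdis, hXY.1.closure, hdis.sdiff_eq_left]
  · rw [hset, ← h.2.2.1, Matroid.eRank_delete_singleton_of_not_isColoop hp, ← hXY.2,
      Matroid.delete_eq_restrict, Matroid.restrict_eRk_eq]
    exact subset_sdiff.2 ⟨hXY.1.subset_ground, hdis⟩

lemma Conformal.forget (h : Conformal X Y) :
    Conformal (forget p X) (OrientedMatroid.forget p Y) := by
  intro x hx hy
  by_cases hxp : x = p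
  · rw [hxp, forget_self, forget_self]
  · rw [forget_apply hxp] at *
    rw [forget_apply hxp] at *
    exact h x hx hy

/-- The comparison of `IsElimination.apply_eq_neg_mul` read in the original oriented matroid: the
direction of an edge of the extension is given by the localization of the cocircuit obtained by
eliminating `f` between `-X` and `Y`. -/
lemma IsExtension.apply_eq_neg_mul (h : O.IsExtension O' p σ) (hX : X ∈ O'.cocircuits)
    (hY : Y ∈ O'.cocircuits) (hXY : O'.Comodular X Y) (hXp : X p = 1) (hYp : Y p = 1)
    {c : SignType} (hc : c ≠ 0) (hfp : f ≠ p) (hXf : X f = c) (hYf : Y f = c)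
    (hF : O.IsElimination f (-forget p X) (forget p Y) F) (hZ : O'.IsElimination p (-X) Y Z) :
    Z f = -c * σ F := by
  obtain ⟨W, hW, hWp, hWF⟩ := h.2.2.2 F hF.1
  have hWE : O'.IsElimination f (-X) Y W := by
    refine ⟨hW, by rw [hWF f hfp, hF.2.1], fun x hx => ?_⟩
    by_cases hxp : x = p
    · rw [hxp] at hx ⊢
      rw [Pi.neg_apply, hXp, hYp]
      rcases SignType.trichotomy (W p) with h' | h' | h'
      exacts [.inl h', absurd h' hx, .inr h']
    · rw [hWF x hxp] at hx ⊢
      simpa [forget_apply hxp] using hF.2.2 x hx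
  rw [← hWp]
  exact hWE.apply_eq_neg_mul hX hY hXY hXp hYp hc hXf hYf hZ

end Extension

/-- If the leading nonzero entry of `X` along `e₁, …, e_k` comes before that of `Y`, then the
cocircuit obtained by eliminating `f` still has negative leading entry: it lies closer to `-X`. -/
lemma lexLocalization_eq_neg_one (hX : X ∈ O.cocircuits) (hY : Y ∈ O.cocircuits)
    (h : O.Comodular X Y) (hYf : Y f ≠ 0) (hF : O.IsElimination f (-X) Y F) {i j : Fin k}
    (hij : i < j) (hXi : ∀ m < i, X (e m) = 0) (hXi1 : X (e i) = 1)
    (hYj : ∀ m < j, Y (e m) = 0) : lexLocalization e F = -1 := by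
  have hXi0 : X (e i) ≠ 0 := by simp [hXi1]
  have hne : F (e i) ≠ 0 := by
    intro h0
    rcases h.eq_or_eq_neg hF.1 hY (fun x => hF.apply_eq_zero) (fun x _ hx => hx)
      (mem_ground_of_ne_zero hX hXi0) (fun h => hXi0 h.1) h0 (hYj i hij) with rfl | rfl
    · exact hYf hF.2.1
    · exact hYf (by simpa using hF.2.1)
  rw [lexLocalization_eq (fun m hm => hF.apply_eq_zero (hXi m hm) (hYj m (hm.trans hij))) hne]
  rcases hF.2.2 _ hne with h' | h'
  · rw [h', Pi.neg_apply, hXi1]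
  · exact absurd (h'.trans (hYj i hij)) hne

lemma le_spanIndex (hX : X ∈ O.cocircuits) (hI : range e ⊆ O.toMatroid.E) {i : Fin k}
    (hXi : ∀ j < i, X (e j) = 0) (hXf : X f ≠ 0) : i.val + 1 ≤ O.spanIndex e f := by
  have hne : {l | (1 ≤ l ∧ l ≤ k ∧ f ∈ O.toMatroid.closure (e '' {j | j.val < l})) ∨
      l = k + 1}.Nonempty := ⟨k + 1, .inr rfl⟩
  rcases Nat.sInf_mem hne with ⟨-, -, hf⟩ | hl
  · by_contra hlt
    refine hXf (eq_zero_of_mem_closure hX ((image_subset_range _ _).trans hI) ?_ hf)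
    rintro _ ⟨j, hj, rfl⟩
    refine hXi j (Fin.lt_def.2 ?_)
    have : j.val < O.spanIndex e f := hj
    omega
  · have : O.spanIndex e f = k + 1 := hl
    omega

lemma mem_closure_of_spanIndex_le {i : Fin k} (h : O.spanIndex e f ≤ i.val + 1) :
    f ∈ O.toMatroid.closure (e '' {j | j ≤ i}) := by
  have hne : {l | (1 ≤ l ∧ l ≤ k ∧ f ∈ O.toMatroid.closure (e '' {j | j.val < l})) ∨
      l = k + 1}.Nonempty := ⟨k + 1, .inr rfl⟩
  rcases Nat.sInf_mem hne with ⟨-, -, hf⟩ | hl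
  · refine O.toMatroid.closure_subset_closure (image_mono fun j hj => ?_) hf
    have : j.val < O.spanIndex e f := hj
    exact Fin.le_def.2 (by omega)
  · have : O.spanIndex e f = k + 1 := hl
    omega

/-! ### The extended program -/

section LexExtension

variable {O' : OrientedMatroid α} {p : α}

lemma IsLexExtension.apply_ne (h : O.IsLexExtension O' p e)
    (hI : O.toMatroid.Indep (range e)) (i : Fin k) : e i ≠ p :=
  h.ne_of_mem (hI.subset_ground (mem_range_self i))

/-- An element of an independent set lies in some cocircuit, so the localization is not zero. -/
lemma exists_lexLocalization_ne_zero (hk : 1 ≤ k) (hI : O.toMatroid.Indep (range e)) :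
    ∃ Y ∈ O.cocircuits, lexLocalization e Y ≠ 0 := by
  obtain ⟨K, hK, hKe⟩ := hI.exists_isCocircuit_inter_eq_mem (mem_range_self (⟨0, hk⟩ : Fin k))
  obtain ⟨Y, hY, rfl⟩ := (O.isCocircuit_iff K).1 hK
  have h0 : Y (e ⟨0, hk⟩) ≠ 0 :=
    (hKe ▸ mem_singleton _ : e ⟨0, hk⟩ ∈ Function.support Y ∩ range e).1
  refine ⟨Y, hY, ?_⟩
  rw [lexLocalization_eq (fun j hj => absurd (Fin.lt_def.1 hj) (Nat.not_lt_zero _)) h0]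
  exact h0

lemma IsLexExtension.isProgram (h : O.IsLexExtension O' p e) (hf : f ∈ O.toMatroid.E) (hk : 1 ≤ k)
    (hI : O.toMatroid.Indep (range e))
    (h₁ : ∀ i : Fin k, i.val + 1 < O.spanIndex e f →
      (O.contract (e '' {j | j < i})).IsEuclideanProgram (e i) f) : O'.IsProgram p f := by
  obtain ⟨Y, hY, hσ⟩ := exists_lexLocalization_ne_zero hk hI
  obtain ⟨X, hX, hXp, -⟩ := h.2.2.2 Y hY
  have hXp0 : X p ≠ 0 := hXp ▸ hσ
  refine ⟨mem_ground_of_ne_zero hX hXp0, h.2.1 ▸ mem_insert_of_mem p hf, (h.ne_of_mem hf).symm,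
    fun hl => ?_, fun hcl => ?_⟩
  · exact hXp0 (eq_zero_of_mem_closure hX (empty_subset _) (by simp) (hl.mem_closure ∅))
  have hfp := h.ne_of_mem hf
  have hclO : O.toMatroid.IsColoop f := by
    rw [← h.2.2.1, Matroid.delete_isColoop_iff]
    refine ⟨fun hf' => ?_, hcl.mem_ground, hfp⟩
    exact (Matroid.isColoop_iff_notMem_closure_compl hcl.mem_ground).1 hcl
      (O'.toMatroid.closure_subset_closure (sdiff_subset_sdiff_left sdiff_subset) hf')
  -- The cocircuit `{f}` of `O` extends to the cocircuit `{f}` of `O'`, so it avoids `e₁, …, e_k`.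
  obtain ⟨V, hV, hVf⟩ := (O.isCocircuit_iff _).1 hclO.isCocircuit
  have hVf0 : V f ≠ 0 := (hVf ▸ mem_singleton f : f ∈ Function.support V)
  obtain ⟨W, hW, hWp, hWV⟩ := h.2.2.2 V hV
  have hWf : ({f} : Set α) = Function.support W := by
    refine hcl.isCocircuit.isCircuit.eq_of_subset_isCircuit (isCocircuit_support hW).isCircuit ?_
    rw [singleton_subset_iff, Function.mem_support, hWV f hfp]
    exact hVf0
  have hVe : ∀ i, V (e i) = 0 := by
    intro i
    by_contra hi
    have hpW : p ∈ Function.support W := by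
      rw [Function.mem_support, hWp]
      exact lexLocalization_ne_zero hi
    rw [← hWf] at hpW
    exact hfp hpW.symm
  by_cases hl : (⟨0, hk⟩ : Fin k).val + 1 < O.spanIndex e f
  · refine (h₁ _ hl).1.2.2.2.2 (Matroid.contract_isColoop_iff.2 ⟨hclO, ?_⟩)
    rintro ⟨j, hj, -⟩
    exact Nat.not_lt_zero _ (Fin.lt_def.1 hj)
  · refine hVf0 (eq_zero_of_mem_closure hV ((image_subset_range _ _).trans hI.subset_ground) ?_
      (mem_closure_of_spanIndex_le (not_lt.1 hl)))
    rintro _ ⟨j, -, rfl⟩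
    exact hVe j

/-- Edges of the extension between vertices with the same leading index `i` are edges of the
program `(O / {e₁, …, e_{i-1}}, e_i, f)`. -/
lemma IsLexExtension.isGraphEdge_contract (h : O.IsLexExtension O' p e)
    (hI : O.toMatroid.Indep (range e)) (hp : ¬ O'.toMatroid.IsColoop p)
    (hXY : O'.IsGraphEdge p X Y) {i : Fin k}
    (hX : ∀ j < i, X (e j) = 0) (hXi : X (e i) = 1) (hY : ∀ j < i, Y (e j) = 0)
    (hYi : Y (e i) = 1) :
    (O.contract (e '' {j | j < i})).IsGraphEdge (e i) (forget p X) (forget p Y) := by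
  obtain ⟨⟨hXc, hXp⟩, ⟨hYc, hYp⟩, hcom, hconf⟩ := hXY
  have hXp0 : X p ≠ 0 := by simp [hXp]
  have hYp0 : Y p ≠ 0 := by simp [hYp]
  have hzero : ∀ {V : SignVector α}, (∀ j < i, V (e j) = 0) →
      ∀ a ∈ e '' {j | j < i}, forget p V a = 0 := by
    rintro V hV _ ⟨j, hj, rfl⟩
    rw [forget_apply (h.apply_ne hI j), hV j hj]
  have hne := h.apply_ne hI i
  exact ⟨⟨⟨(h.forget_mem (lexLocalization_neg e) hp hXc hXp0).1, hzero hX⟩,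
      by rw [forget_apply hne, hXi]⟩,
    ⟨⟨(h.forget_mem (lexLocalization_neg e) hp hYc hYp0).1, hzero hY⟩,
      by rw [forget_apply hne, hYi]⟩,
    (h.comodular_forget hp hXp0 hcom).contract (hI.subset (image_subset_range _ _))
      (hzero hX) (hzero hY), hconf.forget⟩

end LexExtension

end OrientedMatroid


/-! ### Cycles of the extended program -/

open OrientedMatroid

theorem mainTheorem4 {α : Type*} (O O' : OrientedMatroid α) (f p : α)
    (hf : f ∈ O.toMatroid.E)
    -- the ordered independent set `I = [e₁, …, e_k]`; `e_i` is `e (i - 1)`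
    (k : ℕ) (hk : 1 ≤ k) (e : Fin k → α) (he : Function.Injective e)
    (hI : O.toMatroid.Indep (Set.range e))
    -- (i) `(O / {e₁, …, e_{i-1}}, e_i, f)` is Euclidean for `1 ≤ i < l`
    (h₁ : ∀ i : Fin k, i.val + 1 < O.spanIndex e f →
      (O.contract (e '' {j | j < i})).IsEuclideanProgram (e i) f)
    -- (ii) `(O / {e₁, …, e_{i-1}}, e_i, e_j)` is Euclidean for `1 ≤ i ≤ min l (k-1)`, `i < j ≤ k`
    (h₂ : ¬ O.InGeneralPosition f ∨ f ∈ Set.range e →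
      ∀ i j : Fin k, i.val + 1 ≤ min (O.spanIndex e f) (k - 1) → i < j →
        (O.contract (e '' {m | m < i})).IsEuclideanProgram (e i) (e j))
    (hO' : O.IsLexExtension O' p e) :
    O'.IsEuclideanProgram p f := by
  refine ⟨hO'.isProgram hf hk hI h₁, ?_⟩
  rintro ⟨n, P, hcl, hinj, hedge, hdir, m₀, hm₀, hnot⟩
  have hp : ¬ O'.toMatroid.IsColoop p := by
    obtain ⟨Y, hY, hσ⟩ := exists_lexLocalization_ne_zero hk hI
    exact hO'.not_isColoop hY hσ
  have hfp := hO'.ne_of_mem hf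
  have hep := hO'.apply_ne hI
  -- `Z m` is the cocircuit that directs the edge from `P m` to `P (m + 1)`.
  have hZ : ∀ m, ∃ Z, m < n → O'.IsElimination p (-P m) (P (m + 1)) Z ∧ 0 ≤ Z f := by
    intro m
    by_cases hm : m < n
    · rcases hdir m hm with ⟨Z, h, hZf⟩ | ⟨Z, h, hZf⟩
      · exact ⟨Z, fun _ => ⟨h, by rw [hZf]; decide⟩⟩
      · exact ⟨Z, fun _ => ⟨h, hZf.ge⟩⟩
    · exact ⟨0, fun h => absurd h hm⟩
  choose Z hZ using hZ
  have hvert : ∀ m ≤ n, O'.IsVertex p (P m) := by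
    intro m hm
    rcases hm.lt_or_eq with hm | rfl
    · exact (hedge m hm).1
    · rw [hcl]
      exact (hedge 0 (by omega)).1
  -- The sign at `f` is a nonzero constant `c`.
  have hconst := eq_of_monotone_cycle (a := fun m => P m f) (n := n)
    (fun m hm => (hedge m hm).apply_le (hZ m hm).1 (hZ m hm).2) (by rw [hcl])
  obtain ⟨c, hc⟩ : ∃ c, P 0 f = c := ⟨_, rfl⟩
  have hPf : ∀ m ≤ n, P m f = c := fun m hm => (hconst m hm).trans hc
  have hZne : ∃ m < n, Z m f ≠ 0 := ⟨m₀, hm₀, fun h => hnot ⟨Z m₀, (hZ m₀ hm₀).1, h⟩⟩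
  have hc0 : c ≠ 0 := by
    rintro rfl
    obtain ⟨m, hm, hne⟩ := hZne
    exact hne ((hZ m hm).1.apply_eq_zero (hPf m hm.le) (hPf (m + 1) hm))
  -- `Q m` is the cocircuit of `O` underlying the vertex `P m`.
  set Q : ℕ → SignVector α := fun m => forget p (P m) with hQ
  have hQmem : ∀ m ≤ n, Q m ∈ O.cocircuits ∧ lexLocalization e (Q m) = 1 := by
    intro m hm
    have h := hO'.forget_mem (lexLocalization_neg e) hp (hvert m hm).1 (by simp [(hvert m hm).2])
    exact ⟨h.1, h.2.trans (hvert m hm).2⟩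
  have hQf : ∀ m ≤ n, Q m f = c := fun m hm => (forget_apply hfp).trans (hPf m hm)
  have hQcom : ∀ m < n, O.Comodular (Q m) (Q (m + 1)) := fun m hm =>
    hO'.comodular_forget hp (by simp [(hvert m hm.le).2]) (hedge m hm).2.2.1
  have hQne : ∀ i ≤ n, ∀ j ≤ n, Q i = Q j → P i = P j := by
    intro i hi j hj h
    funext x
    by_cases hx : x = p
    · rw [hx, (hvert i hi).2, (hvert j hj).2]
    · have := congrFun h x
      simpa only [hQ, forget_apply hx] using this
  have hQcl : Q n = Q 0 := by simp only [hQ, hcl]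
  -- `F m` is the cocircuit of `O` obtained by eliminating `f` along the edge.
  have hF : ∀ m, ∃ F, m < n → O.IsElimination f (-Q m) (Q (m + 1)) F := by
    intro m
    by_cases hm : m < n
    · have hne : P m ≠ P (m + 1) :=
        (hZ m hm).1.ne (hvert m hm.le).1 (by simp [(hvert m hm.le).2])
      obtain ⟨F, hF⟩ := exists_isElimination (g := f) (hQmem m hm.le).1 (hQmem (m + 1) hm).1
        (fun h => hne (hQne m hm.le (m + 1) hm h)) (by rwa [hQf m hm.le])
        (by rw [hQf m hm.le, hQf (m + 1) hm])
      exact ⟨F, fun _ => hF⟩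
    · exact ⟨0, fun h => absurd h hm⟩
  choose F hF using hF
  have hZF : ∀ m < n, Z m f = -c * lexLocalization e (F m) := fun m hm =>
    hO'.apply_eq_neg_mul (hvert m hm.le).1 (hvert (m + 1) hm).1 (hedge m hm).2.2.1
      (hvert m hm.le).2 (hvert (m + 1) hm).2 hc0 hfp (hPf m hm.le) (hPf (m + 1) hm) (hF m hm)
      (hZ m hm).1
  -- `t m` is the leading index of `Q m`; by the sign at `f`, it is monotone or antitone.
  have ht : ∀ m, ∃ i : Fin k, m ≤ n → (∀ j < i, Q m (e j) = 0) ∧ Q m (e i) = 1 := by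
    intro m
    by_cases hm : m ≤ n
    · obtain ⟨i, h0, hi⟩ := exists_of_lexLocalization_ne_zero (e := e) (Y := Q m)
        (by simp [(hQmem m hm).2])
      exact ⟨i, fun _ => ⟨h0, hi.trans (hQmem m hm).2⟩⟩
    · exact ⟨⟨0, hk⟩, fun h => absurd h hm⟩
  choose t ht using ht
  have htcl : t n = t 0 := by
    have hn := ht n le_rfl
    have h0 := ht 0 (Nat.zero_le n)
    rw [hQcl] at hn
    rcases lt_trichotomy (t n) (t 0) with h | h | h
    · simpa [hn.2] using h0.1 _ h
    · exact h
    · simpa [h0.2] using hn.1 _ h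
  have hup : ∀ m < n, t m < t (m + 1) → c = 1 := by
    intro m hm hlt
    have h := lexLocalization_eq_neg_one (hQmem m hm.le).1 (hQmem (m + 1) hm).1 (hQcom m hm)
      (by rwa [hQf (m + 1) hm]) (hF m hm) hlt (ht m hm.le).1 (ht m hm.le).2 (ht (m + 1) hm).1
    have h2 := (hZ m hm).2
    rw [hZF m hm, h] at h2
    revert h2 hc0
    generalize c = c
    revert c
    decide
  have hdown : ∀ m < n, t (m + 1) < t m → c = -1 := by
    intro m hm hlt
    have h := lexLocalization_eq_neg_one (hQmem (m + 1) hm).1 (hQmem m hm.le).1 (hQcom m hm).symm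
      (by rwa [hQf m hm.le]) (hF m hm).neg_symm hlt (ht (m + 1) hm).1 (ht (m + 1) hm).2
      (ht m hm.le).1
    rw [lexLocalization_neg, neg_inj] at h
    have h2 := (hZ m hm).2
    rw [hZF m hm, h] at h2
    revert h2 hc0
    generalize c = c
    revert c
    decide
  obtain ⟨i, hi⟩ : ∃ i, ∀ m ≤ n, t m = i := by
    refine ⟨t 0, ?_⟩
    by_cases hc1 : c = 1
    · refine eq_of_monotone_cycle (fun m hm => ?_) htcl
      by_contra! h
      have := hc1.symm.trans (hdown m hm h)
      revert this
      decide
    · refine eq_of_monotone_cycle (β := (Fin k)ᵒᵈ) (fun m hm => ?_) htcl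
      by_contra h
      exact hc1 (hup m hm (not_le.1 h))
  have hQ0 : ∀ m ≤ n, ∀ j < i, Q m (e j) = 0 := fun m hm => hi m hm ▸ (ht m hm).1
  have hQi : ∀ m ≤ n, Q m (e i) = 1 := fun m hm => hi m hm ▸ (ht m hm).2
  set A : Set α := e '' {j | j < i} with hA
  -- The cycle, seen in the contraction by the elements before `e i`.
  have hedgeC : ∀ m < n, (O.contract A).IsGraphEdge (e i) (Q m) (Q (m + 1)) := by
    intro m hm
    have hval : ∀ m' j, Q m' (e j) = P m' (e j) := fun m' j => forget_apply (hep j)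
    exact hO'.isGraphEdge_contract hI hp (hedge m hm)
      (fun j hj => hval m j ▸ hQ0 m hm.le j hj) (hval m i ▸ hQi m hm.le)
      (fun j hj => hval (m + 1) j ▸ hQ0 (m + 1) hm j hj) (hval (m + 1) i ▸ hQi (m + 1) hm)
  have hinjC : ∀ a < n, ∀ b < n, Q a = Q b → a = b := fun a ha b hb h =>
    hinj a ha b hb (hQne a ha.le b hb.le h)
  have elimC : ∀ m < n, ∀ W, O.IsElimination (e i) (-Q m) (Q (m + 1)) W →
      (O.contract A).IsElimination (e i) (-Q m) (Q (m + 1)) W := by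
    rintro m hm W hW
    refine ⟨⟨hW.1, ?_⟩, hW.2⟩
    rintro _ ⟨j, hj, rfl⟩
    exact hW.apply_eq_zero (hQ0 m hm.le j hj) (hQ0 (m + 1) hm j hj)
  have hfA : i.val + 1 ≤ O.spanIndex e f :=
    le_spanIndex (hQmem 0 (Nat.zero_le n)).1 hI.subset_ground (hQ0 0 (Nat.zero_le n))
      (by rwa [hQf 0 (Nat.zero_le n)])
  -- All the cocircuits `F m` vanish on `e₁, …, e_k`, so every edge is undirected.
  have hFe : ∀ j, ∀ m < n, F m (e j) = 0 := by
    intro j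
    induction j using WellFoundedLT.induction with
    | ind j ih =>
      have hsign : ∀ m < n, 0 ≤ -c * F m (e j) := by
        intro m hm
        by_cases h0 : F m (e j) = 0
        · rw [h0, mul_zero]
        · rw [← lexLocalization_eq (fun j' hj' => ih j' hj' m hm) h0, ← hZF m hm]
          exact (hZ m hm).2
      rcases lt_trichotomy j i with hji | rfl | hij
      · exact fun m hm => (hF m hm).apply_eq_zero (hQ0 m hm.le j hji) (hQ0 (m + 1) hm j hji)
      · have hW : ∀ m, ∃ W, m < n → O.IsElimination (e j) (-Q m) (Q (m + 1)) W := by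
          intro m
          by_cases hm : m < n
          · obtain ⟨W, hW⟩ := exists_isElimination (g := e j) (hQmem m hm.le).1
              (hQmem (m + 1) hm).1 ((hF m hm).ne (hQmem m hm.le).1 (by rwa [hQf m hm.le]))
              (by simp [hQi m hm.le]) (by rw [hQi m hm.le, hQi (m + 1) hm])
            exact ⟨W, fun _ => hW⟩
          · exact ⟨0, fun h => absurd h hm⟩
        choose W hW using hW
        have hWF : ∀ m < n, W m f = -c * F m (e j) := fun m hm =>
          (hF m hm).apply_eq_neg_mul (hQmem m hm.le).1 (hQmem (m + 1) hm).1 (hQcom m hm)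
            (hQi m hm.le) (hQi (m + 1) hm) hc0 (hQf m hm.le) (hQf (m + 1) hm) (hW m hm)
        have hWf : ∀ m < n, W m f = 0 := by
          by_cases hl : j.val + 1 < O.spanIndex e f
          · exact (h₁ j hl).apply_eq_zero hQcl hinjC hedgeC (fun m hm => elimC m hm _ (hW m hm))
              (s := 1) (by decide) (fun m hm => by
                rw [one_mul, hWF m hm]
                exact hsign m hm)
          · -- Here `f` lies in the closure of `e₁, …, e_j`, on which `W m` vanishes.
            intro m hm
            refine eq_zero_of_mem_closure (hW m hm).1
              ((image_subset_range _ _).trans hI.subset_ground) ?_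
              (mem_closure_of_spanIndex_le (not_lt.1 hl))
            rintro _ ⟨j', hj', rfl⟩
            rcases (le_iff_lt_or_eq.1 hj' : j' < j ∨ j' = j) with h | rfl
            · exact (hW m hm).apply_eq_zero (hQ0 m hm.le j' h) (hQ0 (m + 1) hm j' h)
            · exact (hW m hm).2.1
        intro m hm
        have := (hWF m hm).symm.trans (hWf m hm)
        exact (mul_eq_zero.1 this).resolve_left (by simpa using hc0)
      · -- `F m` vanishes at `e i`, so it directs the edge in the program `(O / A, e i, e j)`.
        have hFC : ∀ m < n, (O.contract A).IsElimination (e i) (-Q m) (Q (m + 1)) (F m) :=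
          fun m hm => elimC m hm _ ((hF m hm).change (ih i hij m hm))
        intro m hm
        have hgen : ¬ O.InGeneralPosition f ∨ f ∈ range e := by
          by_cases hfi : f = e i
          · exact .inr ⟨i, hfi.symm⟩
          · exact .inl (not_inGeneralPosition (hQmem m hm.le).1 (hQcom m hm) hfi
              (by rwa [hQf m hm.le]) (by simp [hQi m hm.le]) (hF m hm) (ih i hij m hm))
        have hik : i.val + 1 ≤ k - 1 := by
          have := Fin.lt_def.1 hij
          omega
        exact (h₂ hgen i j (le_min hfA hik) hij).apply_eq_zero hQcl hinjC hedgeC hFC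
          (s := -c) (by simpa using hc0) hsign m hm
  obtain ⟨m, hm, hne⟩ := hZne
  refine hne ?_
  rw [hZF m hm, lexLocalization_of_forall fun j => hFe j m hm, mul_zero]
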